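/- **Conventions.** Fix a finitary type $\tau:\Omega\to\mathbb N$ and an infinite set $X$. Let $\mathcal U$ be the variety of all algebras $(A,\Omega)$ of type $\tau$ and $F_{\mathcal U}(X)$ the free algebra (term algebra) over $X$. A variety is a class of algebras closed under homomorphic images, subalgebras and products. For an algebra $A$, let $\mathcal P_{>0}^{<\omega}A$ be the set of finite non-empty subsets of $A$; it carries the complex operations $\omega(A_1,\dots,A_n)=\{\omega(a_1,\dots,a_n)\mid a_i\in A_i\}$ and $\cup$. For a variety $\mathcal V\subseteq\mathcal U$, let $\mathcal S_{\mathcal V}$ be the variety of semilattice ordered $\mathcal V$-algebras: algebras $(A,\Omega,+)$ with $(A,\Omega)\in\mathcal V$, $(A,+)$ a semilattice, and every $\omega\in\Omega$ distributing over $+$ in each argument. A subvariety $\mathcal K\subseteq\mathcal S_{\mathcal V}$ is *$\mathcal V$-preserved* if it is non-trivial (has a member with more than one element) and $\mathcal K\not\subseteq\mathcal S_{\mathcal W}$ for every proper subvariety $\mathcal W$ of $\mathcal V$. Let $\Theta$ be a fully invariant congruence of $(\mathcal P_{>0}^{<\omega}F_{\mathcal U}(X),\Omega,\cup)$. Let $\alpha=\tilde\Theta$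 be the congruence $(a,b)\in\alpha\Leftrightarrow(\{a\},\{b\})\in\Theta$ of $F_{\mathcal U}(X)$, let $\mathcal U_\Theta=\mathrm{HSP}(F_{\mathcal U}(X)/\alpha)$ and $A=F_{\mathcal U_\Theta}(X)=F_{\mathcal U}(X)/\alpha$. For a set $Q$ of terms, $Q^\alpha=\{q/\alpha\mid q\in Q\}$. $\mathrm{Clo}^0_{\mathrm{fi}}(A)$ is the set of closure operators $C$ on $A$ that are algebraic ($C(B)=\bigcup\{C(F)\mid F\in\mathcal P_{>0}^{<\omega}B\}$ for all $B\subseteq A$), satisfy $C(\emptyset)=\emptyset$, and are such that: 1. $\omega(C(T_1),\dots,C(T_n))\subseteq C(\omega(T_1,\dots,T_n))$ for every $n$-ary $\omega\in\Omega$ with $n>0$ and all $T_i\in\mathcal P_{>0}^{<\omega}A$; 2. $\varphi(\{r\})\subseteq C(\varphi(T))$ for every endomorphism $\varphi$ of $(\mathcal P_{>0}^{<\omega}A,\Omega,\cup)$, $T\in\mathcal P_{>0}^{<\omega}A$ and $r\in C(T)$; 3. $C(\{a\})=C(\{b\})\Leftrightarrow a=b$ for $a,b\in A$; 4. if $s/\alpha\in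 C(Q^\alpha)$, then $s(P_1^\alpha,\dots,P_n^\alpha)\subseteq C\bigl(\bigcup_{q\in Q}q(P_1^\alpha,\dots,P_n^\alpha)\bigr)$, for all $\{s\},Q,P_1,\dots,P_n\in\mathcal P_{>0}^{<\omega}F_{\mathcal U}(X)$, where terms are evaluated in $(\mathcal P_{>0}^{<\omega}A,\Omega)$. For an operator $C$ on $A$, let $\Upsilon_C=\{(Q,R)\in(\mathcal P_{>0}^{<\omega}A)^2\mid C(Q)=C(R)\}$, and for a relation $\Psi$ on $\mathcal P_{>0}^{<\omega}A$ let $C_\Psi(T)=\{a\in A\mid \exists\,U\in\mathcal P_{>0}^{<\omega}T:\ (U\cup\{a\},U)\in\Psi\}$ for $T\subseteq A$. Order $\mathrm{Clo}^0_{\mathrm{fi}}(A)$ by $C_1\le C_2\Leftrightarrow\Upsilon_{C_2}\subseteq\Upsilon_{C_1}$. **Theorem 5.11.** The $\mathcal U_\Theta$-preserved subvarieties of $\mathcal S_{\mathcal U_\Theta}$, ordered by inclusion, form a complete join-semilattice (every non-empty set of them has a least upper bound). If $\Theta$ is not the full relation, this semilattice is isomorphic to $(\mathrm{Clo}^0_{\mathrm{fi}}(F_{\mathcal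 U_\Theta}(X)),\le)$. Moreover, for every non-empty family $(C_i)_{i\in I}$ in $\mathrm{Clo}^0_{\mathrm{fi}}(F_{\mathcal U_\Theta}(X))$, the operator $C_{\bigcap_{i\in I}\Upsilon_{C_i}}$ belongs to $\mathrm{Clo}^0_{\mathrm{fi}}(F_{\mathcal U_\Theta}(X))$ and is the least upper bound of $\{C_i\}_{i\in I}$ with respect to $\le$. -/

import Mathlib

universe u v

namespace SemilatticeOrdered

/-- An algebra `(A, Ω)` of the finitary type `τ : Ω → ℕ`. -/
structure Alg {Ω : Type u} (τ : Ω → ℕ) : Type (u + 1) where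
  carrier : Type u
  op : (ω : Ω) → (Fin (τ ω) → carrier) → carrier

instance {Ω : Type u} {τ : Ω → ℕ} : CoeSort (Alg τ) (Type u) := ⟨Alg.carrier⟩

/-- Homomorphisms of algebras of the same type. -/
structure Hom {Ω : Type u} {τ : Ω → ℕ} (A B : Alg τ) where
  toFun : A → B
  map_op : ∀ (ω : Ω) (x : Fin (τ ω) → A), toFun (A.op ω x) = B.op ω (fun i => toFun (x i))

/-- The direct product of a family of algebras. -/
abbrev prodAlg {Ω : Type u} {τ : Ω → ℕ} {I : Type u} (A : I → Alg τ) : Alg τ where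
  carrier := (i : I) → A i
  op ω x := fun i => (A i).op ω (fun j => x j i)

/-- A variety: a class of algebras closed under homomorphic images, (isomorphic copies of)
subalgebras, and direct products. -/
structure IsVariety {Ω : Type u} {τ : Ω → ℕ} (V : Set (Alg τ)) : Prop where
  image : ∀ (A B : Alg τ) (f : Hom A B), Function.Surjective f.toFun → A ∈ V → B ∈ V
  sub : ∀ (A B : Alg τ) (f : Hom B A), Function.Injective f.toFun → A ∈ V → B ∈ V
  prod : ∀ (I : Type u) (A : I → Alg τ), (∀ i, A i ∈ V) → prodAlg A ∈ V

/-- `HSP(A)`: all homomorphic images of subalgebras of powers of `A`. -/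
def HSP {Ω : Type u} {τ : Ω → ℕ} (A : Alg τ) : Set (Alg τ) :=
  {B | ∃ (I : Type u) (S : Alg τ) (i : Hom S (prodAlg fun _ : I => A)) (p : Hom S B),
    Function.Injective i.toFun ∧ Function.Surjective p.toFun}

/-- A congruence of an algebra. -/
structure Congruence {Ω : Type u} {τ : Ω → ℕ} (A : Alg τ) extends Setoid A where
  compat : ∀ (ω : Ω) (x y : Fin (τ ω) → A), (∀ i, r (x i) (y i)) → r (A.op ω x) (A.op ω y)

/-- A congruence is fully invariant if every endomorphism preserves it. -/
def Congruence.FullyInvariant {Ω : Type u} {τ : Ω → ℕ} {A : Alg τ} (θ : Congruence A) : Prop :=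
  ∀ (φ : Hom A A) (a b : A), θ.r a b → θ.r (φ.toFun a) (φ.toFun b)

/-- The class `a/θ`. -/
abbrev Congruence.cls {Ω : Type u} {τ : Ω → ℕ} {A : Alg τ} (θ : Congruence A) (a : A) :
    Quotient θ.toSetoid :=
  Quotient.mk θ.toSetoid a

/-- The quotient algebra `A/θ`, with operations computed on representatives
(see `quot_op` for independence of their choice). -/
noncomputable abbrev quot {Ω : Type u} {τ : Ω → ℕ} (A : Alg τ) (θ : Congruence A) : Alg τ where
  carrier := Quotient θ.toSetoid
  op ω x := θ.cls (A.op ω fun i => (x i).out)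

theorem quot_op {Ω : Type u} {τ : Ω → ℕ} (A : Alg τ) (θ : Congruence A) (ω : Ω)
    (x : Fin (τ ω) → A) : (quot A θ).op ω (fun i => θ.cls (x i)) = θ.cls (A.op ω x) :=
  Quotient.sound (θ.compat ω _ _ fun i => Quotient.mk_out (x i))

/-- Terms of type `τ` over the set `X` of variables. -/
inductive Term {Ω : Type u} (τ : Ω → ℕ) (X : Type u) : Type u
  | var : X → Term τ X
  | app : (ω : Ω) → (Fin (τ ω) → Term τ X) → Term τ X

/-- The value of a term in an algebra, under an assignment of elements to the variables. -/
def Term.eval {Ω : Type u} {τ : Ω → ℕ} {X : Type u} (A : Alg τ) (e : X → A) : Term τ X → A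
  | .var x => e x
  | .app ω t => A.op ω fun i => (t i).eval A e

/-- The free algebra `F_𝒰(X)` in the variety `𝒰` of all algebras of type `τ`: the term algebra. -/
abbrev freeAlg {Ω : Type u} (τ : Ω → ℕ) (X : Type u) : Alg τ where
  carrier := Term τ X
  op := Term.app

/-- The type `Ω ∪ {+}`; `none` is the binary symbol `+`. -/
abbrev extType {Ω : Type u} (τ : Ω → ℕ) : Option Ω → ℕ
  | none => 2
  | some ω => τ ω

/-- The reduct `(A, Ω)` of `(A, Ω, +)`. -/
abbrev reduct {Ω : Type u} {τ : Ω → ℕ} (A : Alg (extType τ)) : Alg τ where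
  carrier := A
  op ω x := A.op (some ω) x

/-- The operation `+` of `(A, Ω, +)`. -/
abbrev plus {Ω : Type u} {τ : Ω → ℕ} (A : Alg (extType τ)) (a b : A) : A :=
  A.op none ![a, b]

/-- `(A, Ω, +)` is a semilattice ordered algebra: `+` is a semilattice operation, and each
operation in `Ω` distributes over `+` in each of its arguments. -/
structure IsSemilatticeOrdered {Ω : Type u} {τ : Ω → ℕ} (A : Alg (extType τ)) : Prop where
  assoc : ∀ a b c : A, plus A (plus A a b) c = plus A a (plus A b c)
  comm : ∀ a b : A, plus A a b = plus A b a
  idem : ∀ a : A, plus A a a = a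
  distrib : ∀ (ω : Ω) (i : Fin (τ ω)) (x : Fin (τ ω) → A) (y z : A),
    (reduct A).op ω (Function.update x i (plus A y z)) =
      plus A ((reduct A).op ω (Function.update x i y)) ((reduct A).op ω (Function.update x i z))

/-- `𝒮_𝒱`: all semilattice ordered algebras with `Ω`-reduct in `𝒱`. -/
def SLO {Ω : Type u} {τ : Ω → ℕ} (V : Set (Alg τ)) : Set (Alg (extType τ)) :=
  {A | reduct A ∈ V ∧ IsSemilatticeOrdered A}

/-- `K` is a `𝒱`-preserved subvariety of `𝒮_𝒱`: a subvariety with a member of more than one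
element that is contained in `𝒮_𝒲` for no proper subvariety `𝒲` of `𝒱`. -/
structure IsPreserved {Ω : Type u} {τ : Ω → ℕ} (V : Set (Alg τ)) (K : Set (Alg (extType τ))) :
    Prop where
  variety : IsVariety K
  subset : K ⊆ SLO V
  nontrivial : ∃ A ∈ K, Nontrivial A
  preserved : ∀ W : Set (Alg τ), IsVariety W → W ⊂ V → ¬ K ⊆ SLO W

/-- The set of `𝒱`-preserved subvarieties of `𝒮_𝒱`, ordered by inclusion. -/
abbrev Preserved {Ω : Type u} {τ : Ω → ℕ} (V : Set (Alg τ)) : Type (u + 1) :=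
  {K : Set (Alg (extType τ)) // IsPreserved V K}

/-- The finite non-empty subsets of `A`. -/
abbrev FinPow (A : Type u) : Type u := {s : Set A // s.Nonempty ∧ s.Finite}

/-- `{a}` as a finite non-empty set. -/
def FinPow.single {A : Type u} (a : A) : FinPow A :=
  ⟨{a}, Set.singleton_nonempty a, Set.finite_singleton a⟩

/-- The union of two finite non-empty sets. -/
def FinPow.union {A : Type u} (P Q : FinPow A) : FinPow A :=
  ⟨P.1 ∪ Q.1, P.2.1.inl, P.2.2.union Q.2.2⟩

/-- The image of a finite non-empty set. -/
def FinPow.map {A B : Type u} (f : A → B) (P : FinPow A) : FinPow B :=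
  ⟨f '' P.1, P.2.1.image f, P.2.2.image f⟩

/-- The complex operation `ω(S₁, …, Sₙ) = {ω(a₁, …, aₙ) | aᵢ ∈ Sᵢ}`. -/
def complexOp {Ω : Type u} {τ : Ω → ℕ} (A : Alg τ) (ω : Ω) (S : Fin (τ ω) → Set A) : Set A :=
  {a | ∃ x : Fin (τ ω) → A, (∀ i, x i ∈ S i) ∧ A.op ω x = a}

theorem complexOp_eq_image {Ω : Type u} {τ : Ω → ℕ} (A : Alg τ) (ω : Ω)
    (S : Fin (τ ω) → Set A) : complexOp A ω S = A.op ω '' Set.univ.pi S := by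
  ext a
  simp [complexOp, Set.mem_pi]

/-- The extended power algebra `(𝒫_{>0}^{<ω} A, Ω, ∪)`. -/
abbrev powAlg {Ω : Type u} {τ : Ω → ℕ} (A : Alg τ) : Alg (extType τ) where
  carrier := FinPow A
  op
    | none => fun P => FinPow.union (P (0 : Fin 2)) (P (1 : Fin 2))
    | some ω => fun P => ⟨complexOp A ω fun i => (P i).1, by
        rw [complexOp_eq_image]
        exact ⟨(Set.univ_pi_nonempty_iff.2 fun i => (P i).2.1).image _,
          (Set.Finite.pi fun i => (P i).2.2).image _⟩⟩

theorem powAlg_op_single {Ω : Type u} {τ : Ω → ℕ} (A : Alg τ) (ω : Ω) (x : Fin (τ ω) → A) :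
    (powAlg A).op (some ω) (fun i => FinPow.single (x i)) = FinPow.single (A.op ω x) := by
  apply Subtype.ext
  ext a
  constructor
  · rintro ⟨y, hy, rfl⟩
    have h : y = x := funext fun i => hy i
    subst h
    rfl
  · rintro rfl
    exact ⟨x, fun i => rfl, rfl⟩

/-- The congruence `Θ̃` on `(A, Ω)`: `a` and `b` are related iff `{a}` and `{b}` are. -/
def Congruence.tilde {Ω : Type u} {τ : Ω → ℕ} {A : Alg τ} (Θ : Congruence (powAlg A)) :
    Congruence A where
  r a b := Θ.r (FinPow.single a) (FinPow.single b)
  iseqv := ⟨fun _ => Θ.iseqv.refl _, fun h => Θ.iseqv.symm h, fun h k => Θ.iseqv.trans h k⟩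
  compat ω x y h := by
    have := Θ.compat (some ω) _ _ h
    exact (powAlg_op_single A ω x) ▸ (powAlg_op_single A ω y) ▸ this

/-- The variety `𝒰_α = HSP(F_𝒰(X)/α)`. -/
def varietyOf {Ω : Type u} {τ : Ω → ℕ} {X : Type u} (α : Congruence (freeAlg τ X)) :
    Set (Alg τ) :=
  HSP (quot (freeAlg τ X) α)

/-- The relation `Υ_C`, for an operator `C` on `A`. -/
def upsilon {A : Type u} (C : Set A → Set A) (Q R : FinPow A) : Prop :=
  C Q.1 = C R.1

/-- The operator `C_Θ`, for a relation `Θ` on the finite non-empty subsets of `A`. -/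
def opOf {A : Type u} (Θ : FinPow A → FinPow A → Prop) (T : Set A) : Set A :=
  {a | ∃ U : FinPow A, U.1 ⊆ T ∧ Θ (U.union (FinPow.single a)) U}

/-- `Clo⁰_fi(F_{𝒰_α}(X))`, where `F_{𝒰_α}(X) = F_𝒰(X)/α`. -/
structure CloFi0 {Ω : Type u} {τ : Ω → ℕ} {X : Type u} (α : Congruence (freeAlg τ X)) :
    Type u where
  cl : ClosureOperator (Set (quot (freeAlg τ X) α))
  algebraic : ∀ B, cl B = ⋃ F : {F : FinPow (quot (freeAlg τ X) α) // F.1 ⊆ B}, cl F.1.1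
  empty : cl ∅ = ∅
  /-- `ω(C(T₁), …, C(Tₙ)) ⊆ C(ω(T₁, …, Tₙ))` -/
  op_subset : ∀ (ω : Ω), 0 < τ ω → ∀ T : Fin (τ ω) → FinPow (quot (freeAlg τ X) α),
    complexOp (quot (freeAlg τ X) α) ω (fun i => cl (T i).1) ⊆
      cl (complexOp (quot (freeAlg τ X) α) ω fun i => (T i).1)
  /-- `φ({r}) ⊆ C(φ(T))` for `r ∈ C(T)` and each endomorphism `φ` of the extended power algebra -/
  endo_subset : ∀ (φ : Hom (powAlg (quot (freeAlg τ X) α)) (powAlg (quot (freeAlg τ X) α)))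
    (T : FinPow (quot (freeAlg τ X) α)) (r : quot (freeAlg τ X) α), r ∈ cl T.1 →
      (φ.toFun (FinPow.single r)).1 ⊆ cl (φ.toFun T).1
  singleton_inj : ∀ a b : quot (freeAlg τ X) α, cl {a} = cl {b} ↔ a = b
  /-- If `s/α ∈ C(Q^α)` then `s(P₁^α, …, Pₙ^α) ⊆ C(⋃ {q(P₁^α, …, Pₙ^α) | q ∈ Q})`, where terms are
  evaluated in the power algebra of `F_𝒰(X)/α`. A family `P` assigns a set to every variable;
  only the finitely many variables that occur in `s` and in `Q` matter. -/
  subst : ∀ (s : Term τ X) (Q : FinPow (freeAlg τ X)) (P : X → FinPow (freeAlg τ X)),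
    α.cls s ∈ cl (Q.map α.cls).1 →
      (s.eval (reduct (powAlg (quot (freeAlg τ X) α))) fun x => (P x).map α.cls).1 ⊆
        cl (⋃ q ∈ Q.1, (Term.eval (reduct (powAlg (quot (freeAlg τ X) α)))
          (fun x => (P x).map α.cls) q).1)

/-- The order `C₁ ≤ C₂ ↔ Υ_{C₂} ⊆ Υ_{C₁}`. -/
instance {Ω : Type u} {τ : Ω → ℕ} {X : Type u} (α : Congruence (freeAlg τ X)) :
    Preorder (CloFi0 α) where
  le C D := ∀ Q R, upsilon D.cl Q R → upsilon C.cl Q R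
  le_refl _ _ _ h := h
  le_trans _ _ _ h k Q R hQR := h Q R (k Q R hQR)

end SemilatticeOrdered

open SemilatticeOrdered

/-! Write A = F_𝒰(X)/α. Closure operators and preserved subvarieties are both encoded by congruences
Υ of the extended power algebra of A that separate singletons and are closed under substituting
finite sets for variables (`IsAdmissible`).

Operators: C ↦ Υ_C and Υ ↦ C_Υ are mutually inverse, because R lies in the closure of Q exactly when
Υ relates Q ∪ R and Q (`subset_opOf_iff`), and an algebraic operator with C(∅) = ∅ is determined by
its values on finite non-empty sets (`closure_eq_opOf`).

Subvarieties: the extended power algebra of the term algebra is the free semilattice ordered algebra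
over X (`Hom.extend`, `powAlg_free_hom_ext`). Identities in Ω ∪ {+} are thus pairs of finite sets of
terms, and Birkhoff's theorem makes `idOf` and `modOf` mutually inverse. Preservation corresponds to
separating singletons: a collapse of two singletons is an Ω-identity of all reducts and cuts out a
proper subvariety; conversely, singletons embed A, which generates 𝒰_Θ, into a reduct. Substitutions
are homomorphisms from the power algebra of terms, since the power algebra of A may violate
identities of A with repeated variables.

Both passages reverse inclusion, so their composite is an order isomorphism. Admissible congruences
are closed under non-empty intersections, which yields the suprema; if A is trivial, there is no
preserved subvariety at all. -/

namespace SemilatticeOrdered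

/-! ### Homomorphisms, terms, quotients and products. -/

section Basic

variable {Ω : Type u} {τ : Ω → ℕ} {X : Type u}

/-- The composition of two homomorphisms. -/
def Hom.comp {A B C : Alg τ} (g : Hom B C) (f : Hom A B) : Hom A C where
  toFun a := g.toFun (f.toFun a)
  map_op ω x := by rw [f.map_op, g.map_op]

/-- A homomorphism of `Ω ∪ {+}`-algebras as a homomorphism of the `Ω`-reducts. -/
def Hom.mapReduct {A B : Alg (extType τ)} (f : Hom A B) :
    Hom (reduct A) (reduct B) where
  toFun := f.toFun
  map_op ω x := f.map_op (some ω) x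

theorem Hom.map_plus {A B : Alg (extType τ)} (f : Hom A B) (a b : A) :
    f.toFun (plus A a b) = plus B (f.toFun a) (f.toFun b) := by
  refine (f.map_op none ![a, b]).trans (congrArg (B.op none) (funext fun i => ?_))
  exact Fin.cases rfl (fun j => by rw [Subsingleton.elim j 0]; rfl) (i : Fin 2)

/-- Evaluation of terms, as a homomorphism from the term algebra. -/
def evalHom (A : Alg τ) (e : X → A) : Hom (freeAlg τ X) A where
  toFun := Term.eval A e
  map_op _ _ := rfl

theorem Hom.map_eval {A B : Alg τ} (f : Hom A B) (e : X → A) (t : Term τ X) :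
    f.toFun (t.eval A e) = t.eval B fun x => f.toFun (e x) := by
  induction t with
  | var x => rfl
  | app ω t ih => exact (f.map_op ω _).trans (congrArg (B.op ω) (funext ih))

theorem Term.eval_var (t : Term τ X) : t.eval (freeAlg τ X) Term.var = t := by
  induction t with
  | var x => rfl
  | app ω t ih => exact congrArg (Term.app ω) (funext ih)

theorem Hom.apply_eq_eval {A : Alg τ} (f : Hom (freeAlg τ X) A) (t : Term τ X) :
    f.toFun t = t.eval A fun x => f.toFun (Term.var x) := by
  have h := f.map_eval Term.var t
  rwa [Term.eval_var] at h

/-- The value of a term depends on finitely many variables only. -/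
theorem Term.exists_finite_support (t : Term τ X) :
    ∃ s : Set X, s.Finite ∧ ∀ (A : Alg τ) (e e' : X → A), Set.EqOn e e' s →
      t.eval A e = t.eval A e' := by
  induction t with
  | var x => exact ⟨{x}, Set.finite_singleton x, fun A e e' h => h rfl⟩
  | app ω t ih =>
    choose s hs h using ih
    exact ⟨⋃ i, s i, Set.finite_iUnion hs, fun A e e' he => congrArg (A.op ω)
      (funext fun i => h i A e e' fun x hx => he (Set.mem_iUnion_of_mem i hx))⟩

/-- The projection onto a quotient algebra. -/
noncomputable def clsHom {A : Alg τ} (θ : Congruence A) : Hom A (quot A θ) where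
  toFun := θ.cls
  map_op ω x := (quot_op A θ ω x).symm

theorem clsHom_surjective {A : Alg τ} (θ : Congruence A) :
    Function.Surjective (clsHom θ).toFun :=
  Quotient.mk_surjective

/-- The homomorphism induced on a quotient by a homomorphism that respects the congruence. -/
noncomputable def Congruence.lift {A B : Alg τ} (θ : Congruence A) (f : Hom A B)
    (h : ∀ a b, θ.r a b → f.toFun a = f.toFun b) : Hom (quot A θ) B where
  toFun := Quotient.lift f.toFun h
  map_op ω x := by
    refine (f.map_op ω _).trans (congrArg (B.op ω) (funext fun i => ?_))
    conv_rhs => rw [← Quotient.out_eq (x i)]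
    rfl

/-- The projection of a product onto a factor. -/
def projHom {I : Type u} (A : I → Alg τ) (i : I) : Hom (prodAlg A) (A i) where
  toFun x := x i
  map_op _ _ := rfl

/-- The homomorphism into a product with given components. -/
def Hom.pi {I : Type u} {A : I → Alg τ} {B : Alg τ} (f : ∀ i, Hom B (A i)) :
    Hom B (prodAlg A) where
  toFun b i := (f i).toFun b
  map_op ω x := funext fun i => (f i).map_op ω x

end Basic

/-! ### Varieties, identities and Birkhoff's theorem. -/

section Birkhoff

variable {Ω : Type u} {τ : Ω → ℕ}

/-- The congruence of all identities, in the variables `Y`, that hold in the class `V`. -/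
def identities (V : Set (Alg τ)) (Y : Type u) : Congruence (freeAlg τ Y) where
  r s t := ∀ B ∈ V, ∀ e : Y → B, Term.eval B e s = Term.eval B e t
  iseqv := ⟨fun _ _ _ _ => rfl, fun h B hB e => (h B hB e).symm,
    fun h k B hB e => (h B hB e).trans (k B hB e)⟩
  compat ω _ _ h B hB e := congrArg (B.op ω) (funext fun i => h i B hB e)

/-- One refuting algebra of `V` is chosen for each failing pair of terms; the quotient embeds into
their product. Indexing by pairs of terms keeps the product small although `V` is a proper class. -/
theorem quot_identities_mem {V : Set (Alg τ)} (hV : IsVariety V) (Y : Type u) :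
    quot (freeAlg τ Y) (identities V Y) ∈ V := by
  have key : ∀ p : {p : Term τ Y × Term τ Y // ¬ (identities V Y).r p.1 p.2},
      ∃ B : Alg τ, B ∈ V ∧ ∃ e : Y → B, p.1.1.eval B e ≠ p.1.2.eval B e := by
    intro p
    have h : ¬ ∀ B ∈ V, ∀ e : Y → B, p.1.1.eval B e = p.1.2.eval B e := p.2
    push Not at h
    obtain ⟨B, hB, e, he⟩ := h
    exact ⟨B, hB, e, he⟩
  choose B hB e he using key
  refine hV.sub _ _ (Hom.pi fun p => (identities V Y).lift (evalHom (B p) (e p))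
    fun s t h => h (B p) (hB p) (e p)) ?_ (hV.prod _ B hB)
  intro a b
  induction a using Quotient.inductionOn with | h a => ?_
  induction b using Quotient.inductionOn with | h b => ?_
  intro hab
  by_contra hne
  exact he ⟨(a, b), fun h => hne (Quotient.sound h)⟩ (congrFun hab _)

/-- Birkhoff's theorem: an algebra that satisfies the identities of a variety, in infinitely many
variables, belongs to the variety. -/
theorem mem_of_identities {X : Type u} [Infinite X] {V : Set (Alg τ)} (hV : IsVariety V)
    (B : Alg τ) (hB : ∀ s t : Term τ X, (identities V X).r s t →
      ∀ e : X → B, s.eval B e = t.eval B e) : B ∈ V := by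
  -- `B` is an image of the relatively free algebra with the elements of `B` as variables.
  refine hV.image _ B ((identities V B).lift (evalHom B id) fun s t hst => ?_)
    (fun b => ⟨(identities V B).cls (Term.var b), rfl⟩) (quot_identities_mem hV B)
  obtain ⟨S, hS, hs⟩ := s.exists_finite_support
  obtain ⟨T, hT, ht⟩ := t.exists_finite_support
  have : Nonempty B := ⟨s.eval B id⟩
  have hfin := (hS.union hT)
  have := hfin.to_subtype
  obtain ⟨f⟩ : Nonempty ((S ∪ T : Set B) ↪ X) := by
    have := Fintype.ofFinite (S ∪ T : Set B)
    exact ⟨Function.Embedding.trans (Fintype.equivFin _).toEmbedding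
      (Fin.valEmbedding.trans (Infinite.natEmbedding X))⟩
  obtain ⟨x₀⟩ : Nonempty X := inferInstance
  classical
  -- The finitely many variables that matter are renamed injectively into `X`; `k` below undoes the
  -- renaming, and the value `x₀` elsewhere is irrelevant.
  let g : B → X := fun b => if hb : b ∈ S ∪ T then f ⟨b, hb⟩ else x₀
  have hg : Set.InjOn g (S ∪ T) := by
    intro a ha b hb hab
    simp only [g, dif_pos ha, dif_pos hb] at hab
    exact congrArg Subtype.val (f.injective hab)
  let k : X → B := Function.invFunOn g (S ∪ T)
  have hk : Set.EqOn id (fun b => k (g b)) (S ∪ T) := fun b hb =>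
    (hg.leftInvOn_invFunOn hb).symm
  let G := evalHom (freeAlg τ X) fun b => Term.var (g b)
  have hG : ∀ r : Term τ B, (G.toFun r).eval B k = r.eval B fun b => k (g b) := fun r =>
    (evalHom B k).map_eval _ r
  have h := hB (G.toFun s) (G.toFun t) (fun C hC e => by
    have h := hst C hC fun b => e (g b)
    have hG' : ∀ r : Term τ B, (G.toFun r).eval C e = r.eval C fun b => e (g b) := fun r =>
      (evalHom C e).map_eval _ r
    rwa [hG', hG']) k
  rw [hG, hG] at h
  exact (hs B _ _ (hk.mono Set.subset_union_left)).trans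
    (h.trans (ht B _ _ (hk.mono Set.subset_union_right)).symm)

theorem isVariety_HSP (A : Alg τ) : IsVariety (HSP A) where
  image := by
    rintro B D f hf ⟨I, S, i, p, hi, hp⟩
    exact ⟨I, S, i, f.comp p, hi, hf.comp hp⟩
  sub := by
    rintro B D f hf ⟨I, S, i, p, hi, hp⟩
    -- The pullback of `p` and `f`: it embeds into `S` and maps onto `D`.
    let S' : Alg τ :=
      { carrier := {q : S × D // p.toFun q.1 = f.toFun q.2}
        op := fun ω x => ⟨(S.op ω fun j => (x j).1.1, D.op ω fun j => (x j).1.2), by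
          rw [p.map_op, f.map_op]
          exact congrArg (B.op ω) (funext fun j => (x j).2)⟩ }
    let i' : Hom S' S := ⟨fun q => q.1.1, fun _ _ => rfl⟩
    let p' : Hom S' D := ⟨fun q => q.1.2, fun _ _ => rfl⟩
    refine ⟨I, S', i.comp i', p', ?_, ?_⟩
    · intro a b hab
      have h₁ : a.1.1 = b.1.1 := hi hab
      exact Subtype.ext (Prod.ext h₁ (hf (by rw [← a.2, ← b.2, h₁])))
    · intro d
      obtain ⟨s, hs⟩ := hp (f.toFun d)
      exact ⟨⟨(s, d), hs⟩, rfl⟩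
  prod := by
    intro J B hB
    choose I S i p hi hp using hB
    refine ⟨Σ j, I j, prodAlg S, ⟨fun s q => (i q.1).toFun (s q.1) q.2, fun ω x => ?_⟩,
      Hom.pi fun j => (p j).comp (projHom S j), ?_, ?_⟩
    · funext q
      exact congrFun ((i q.1).map_op ω _) q.2
    · intro s t hst
      exact funext fun j => hi j (funext fun k => congrFun hst ⟨j, k⟩)
    · intro b
      choose s hs using fun j => hp j (b j)
      exact ⟨s, funext hs⟩

theorem self_mem_HSP (A : Alg τ) : A ∈ HSP A :=
  ⟨PUnit, A, ⟨fun a _ => a, fun _ _ => rfl⟩, ⟨id, fun _ _ => rfl⟩,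
    fun _ _ h => congrFun h PUnit.unit, Function.surjective_id⟩

theorem HSP_subset {A : Alg τ} {V : Set (Alg τ)} (hV : IsVariety V) (hA : A ∈ V) :
    HSP A ⊆ V := by
  rintro B ⟨I, S, i, p, hi, hp⟩
  exact hV.image _ _ p hp (hV.sub _ _ i hi (hV.prod I _ fun _ => hA))

theorem isVariety_inter {V W : Set (Alg τ)} (hV : IsVariety V) (hW : IsVariety W) :
    IsVariety (V ∩ W) where
  image A B f hf h := ⟨hV.image A B f hf h.1, hW.image A B f hf h.2⟩
  sub A B f hf h := ⟨hV.sub A B f hf h.1, hW.sub A B f hf h.2⟩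
  prod I A h := ⟨hV.prod I A fun i => (h i).1, hW.prod I A fun i => (h i).2⟩

/-- The class of algebras that satisfy a set of identities. -/
def models {X : Type u} (r : Term τ X → Term τ X → Prop) : Set (Alg τ) :=
  {B | ∀ s t, r s t → ∀ e : X → B, s.eval B e = t.eval B e}

theorem isVariety_models {X : Type u} (r : Term τ X → Term τ X → Prop) :
    IsVariety (models r) where
  image A B f hf hA s t hst e := by
    choose e' he' using fun x => hf (e x)
    obtain rfl : (fun x => f.toFun (e' x)) = e := funext he'
    rw [← f.map_eval, ← f.map_eval, hA s t hst]
  sub A B f hf hA s t hst e := hf (by rw [f.map_eval, f.map_eval, hA s t hst])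
  prod I A hA s t hst e := funext fun i => by
    have h := hA i s t hst fun x => e x i
    exact ((projHom A i).map_eval e s).trans (h.trans ((projHom A i).map_eval e t).symm)

/-- `F_𝒰(X)/α` satisfies the identities in a fully invariant congruence `α`. -/
theorem quot_mem_models {X : Type u} {α : Congruence (freeAlg τ X)} (hα : α.FullyInvariant) :
    quot (freeAlg τ X) α ∈ models α.r := by
  intro s t hst e
  choose e' he' using fun x => clsHom_surjective α (e x)
  obtain rfl : (fun x => (clsHom α).toFun (e' x)) = e := funext he'
  rw [← (clsHom α).map_eval, ← (clsHom α).map_eval]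
  exact Quotient.sound (hα (evalHom _ e') s t hst)

theorem eval_cls_var {X : Type u} (α : Congruence (freeAlg τ X)) (t : Term τ X) :
    t.eval (quot (freeAlg τ X) α) (fun x => α.cls (Term.var x)) = α.cls t :=
  ((clsHom α).apply_eq_eval t).symm

/-- Evaluating an identity of F_𝒰(X)/α at the classes of the variables shows that it lies in α;
Birkhoff's theorem does the rest. -/
theorem models_eq_varietyOf {X : Type u} [Infinite X] {α : Congruence (freeAlg τ X)}
    (hα : α.FullyInvariant) : models α.r = varietyOf α := by
  refine Set.Subset.antisymm (fun B hB => ?_)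
    (HSP_subset (isVariety_models _) (quot_mem_models hα))
  refine mem_of_identities (X := X) (isVariety_HSP _) B fun s t hst => hB s t ?_
  have h := hst _ (self_mem_HSP _) fun x => α.cls (Term.var x)
  rw [eval_cls_var, eval_cls_var] at h
  exact Quotient.exact h

end Birkhoff

end SemilatticeOrdered

namespace SemilatticeOrdered

/-! ### Finite non-empty subsets. -/

section FinPow

variable {A B C : Type u}

theorem FinPow.single_subset {a : A} {T : Set A} : (FinPow.single a).1 ⊆ T ↔ a ∈ T :=
  Set.singleton_subset_iff

theorem FinPow.union_comm (P Q : FinPow A) : P.union Q = Q.union P :=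
  Subtype.ext (Set.union_comm _ _)

theorem FinPow.union_assoc (P Q R : FinPow A) :
    (P.union Q).union R = P.union (Q.union R) :=
  Subtype.ext (Set.union_assoc _ _ _)

theorem FinPow.union_self (P : FinPow A) : P.union P = P :=
  Subtype.ext (Set.union_self _)

theorem FinPow.union_eq_left {P Q : FinPow A} (h : Q.1 ⊆ P.1) : P.union Q = P :=
  Subtype.ext (Set.union_eq_left.2 h)

theorem FinPow.map_single (f : A → B) (a : A) :
    (FinPow.single a).map f = FinPow.single (f a) :=
  Subtype.ext Set.image_singleton

theorem FinPow.map_union (f : A → B) (P Q : FinPow A) :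
    (P.union Q).map f = (P.map f).union (Q.map f) :=
  Subtype.ext (Set.image_union _ _ _)

theorem FinPow.map_map (g : B → C) (f : A → B) (P : FinPow A) :
    (P.map f).map g = P.map fun a => g (f a) :=
  Subtype.ext (Set.image_image _ _ _)

theorem FinPow.map_id' (P : FinPow A) : (P.map fun a => a) = P :=
  Subtype.ext (Set.image_id' _)

/-- Finite non-empty sets are generated by singletons under unions. -/
theorem FinPow.induction {p : FinPow A → Prop} (single : ∀ a, p (FinPow.single a))
    (union : ∀ P Q, p P → p Q → p (P.union Q)) (P : FinPow A) : p P := by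
  have key : ∀ s : Set A, s.Finite → ∀ h : s.Nonempty ∧ s.Finite, p ⟨s, h⟩ := by
    intro s hs
    induction s, hs using Set.Finite.induction_on with
    | empty => exact fun h => absurd h.1 Set.not_nonempty_empty
    | @insert a s _ hs ih =>
      intro h
      rcases s.eq_empty_or_nonempty with rfl | hne
      · have : (⟨insert a ∅, h⟩ : FinPow A) = FinPow.single a :=
          Subtype.ext (insert_empty_eq a)
        exact this ▸ single a
      · exact union (FinPow.single a) ⟨s, hne, hs⟩ (single a) (ih _)
  exact key P.1 P.2.2 P.2

end FinPow

/-! ### The extended power algebra and its freeness. -/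

section Power

variable {Ω : Type u} {τ : Ω → ℕ}

theorem Hom.map_union {A : Alg τ} {D : Alg (extType τ)} (f : Hom (powAlg A) D)
    (P Q : FinPow A) : f.toFun (P.union Q) = plus D (f.toFun P) (f.toFun Q) :=
  f.map_plus P Q

/-- A map that preserves all `Ω`-operations and `+` is a homomorphism. -/
def Hom.ofPlus {A B : Alg (extType τ)} (f : A → B)
    (op : ∀ (ω : Ω) (x : Fin (τ ω) → A), f (A.op (some ω) x) = B.op (some ω) fun i => f (x i))
    (add : ∀ a b, f (plus A a b) = plus B (f a) (f b)) : Hom A B where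
  toFun := f
  map_op
    | none => fun x => by
      have hx : x = ![x (0 : Fin 2), x (1 : Fin 2)] := funext fun i =>
        Fin.cases rfl (fun j => by rw [Subsingleton.elim j 0]; rfl) (i : Fin 2)
      have hy : (fun i => f (x i)) = ![f (x (0 : Fin 2)), f (x (1 : Fin 2))] := funext fun i =>
        Fin.cases rfl (fun j => by rw [Subsingleton.elim j 0]; rfl) (i : Fin 2)
      rw [hy, hx]
      exact add _ _
    | some ω => op ω

theorem complexOp_image {A B : Alg τ} (f : Hom A B) (ω : Ω) (S : Fin (τ ω) → Set A) :
    f.toFun '' complexOp A ω S = complexOp B ω fun i => f.toFun '' S i := by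
  ext b
  constructor
  · rintro ⟨_, ⟨x, hx, rfl⟩, rfl⟩
    exact ⟨fun i => f.toFun (x i), fun i => ⟨x i, hx i, rfl⟩, (f.map_op ω x).symm⟩
  · rintro ⟨y, hy, rfl⟩
    choose x hx hxy using hy
    obtain rfl : (fun i => f.toFun (x i)) = y := funext hxy
    exact ⟨_, ⟨x, hx, rfl⟩, f.map_op ω x⟩

/-- The image map of finite non-empty sets under a homomorphism. -/
def mapHom {A B : Alg τ} (f : Hom A B) : Hom (powAlg A) (powAlg B) :=
  Hom.ofPlus (fun P : FinPow A => P.map f.toFun)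
    (fun ω x => Subtype.ext (complexOp_image f ω fun i => (x i).1))
    (fun P Q => FinPow.map_union f.toFun P Q)

theorem mapHom_apply {A B : Alg τ} (f : Hom A B) (P : FinPow A) :
    (mapHom f).toFun P = P.map f.toFun := rfl

theorem powAlg_hom_ext {A : Alg τ} {D : Alg (extType τ)} {f g : Hom (powAlg A) D}
    (h : ∀ a, f.toFun (FinPow.single a) = g.toFun (FinPow.single a)) (P : FinPow A) :
    f.toFun P = g.toFun P := by
  induction P using FinPow.induction with
  | single a => exact h a
  | union P Q hP hQ => rw [f.map_union, g.map_union, hP, hQ]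

/-- The restriction of a homomorphism to singletons. -/
def Hom.onSingle {A : Alg τ} {D : Alg (extType τ)} (f : Hom (powAlg A) D) :
    Hom A (reduct D) where
  toFun a := f.toFun (FinPow.single a)
  map_op ω x := by rw [← powAlg_op_single]; exact f.map_op (some ω) _

/-- The uniqueness half of freeness over `X`; `Hom.extend` supplies existence. -/
theorem powAlg_free_hom_ext {X : Type u} {D : Alg (extType τ)}
    {f g : Hom (powAlg (freeAlg τ X)) D}
    (h : ∀ x, f.toFun (FinPow.single (Term.var x)) = g.toFun (FinPow.single (Term.var x)))
    (P : FinPow (Term τ X)) : f.toFun P = g.toFun P := by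
  refine powAlg_hom_ext (A := freeAlg τ X) (fun t => ?_) P
  exact (f.onSingle.apply_eq_eval t).trans (((congrArg
    (fun e => Term.eval (reduct D) e t) (funext h))).trans (g.onSingle.apply_eq_eval t).symm)

theorem Hom.apply_eq_iUnion {A B : Alg τ} (f : Hom (powAlg A) (powAlg B)) (P : FinPow A) :
    (f.toFun P).1 = ⋃ a ∈ P.1, (f.toFun (FinPow.single a)).1 := by
  induction P using FinPow.induction with
  | single a => simp [FinPow.single]
  | union P Q hP hQ =>
    have h : (P.union Q).1 = P.1 ∪ Q.1 := rfl
    rw [h, Set.biUnion_union, ← hP, ← hQ, f.map_union]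
    rfl

theorem Hom.apply_mono {A B : Alg τ} (f : Hom (powAlg A) (powAlg B)) {P Q : FinPow A}
    (h : P.1 ⊆ Q.1) : (f.toFun P).1 ⊆ (f.toFun Q).1 := by
  rw [f.apply_eq_iUnion, f.apply_eq_iUnion]
  exact Set.biUnion_subset_biUnion_left h

theorem isSemilatticeOrdered_powAlg (A : Alg τ) : IsSemilatticeOrdered (powAlg A) where
  assoc := FinPow.union_assoc
  comm := FinPow.union_comm
  idem := FinPow.union_self
  distrib ω i x y z := by
    have key : ∀ (w : FinPow A) (v : Fin (τ ω) → A),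
        (∀ j, v j ∈ (Function.update x i w j).1) ↔
          v i ∈ w.1 ∧ ∀ j, j ≠ i → v j ∈ (x j).1 := by
      intro w v
      rw [Function.forall_update_iff x (p := fun j (P : FinPow A) => v j ∈ P.1)]
    apply Subtype.ext
    ext a
    constructor
    · rintro ⟨v, hv, rfl⟩
      obtain ⟨hi, hne⟩ := (key _ v).1 hv
      exact hi.imp (fun hi => ⟨v, (key y v).2 ⟨hi, hne⟩, rfl⟩)
        fun hi => ⟨v, (key z v).2 ⟨hi, hne⟩, rfl⟩
    · rintro (⟨v, hv, rfl⟩ | ⟨v, hv, rfl⟩)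
      · obtain ⟨hi, hne⟩ := (key y v).1 hv
        exact ⟨v, (key _ v).2 ⟨Or.inl hi, hne⟩, rfl⟩
      · obtain ⟨hi, hne⟩ := (key z v).1 hv
        exact ⟨v, (key _ v).2 ⟨Or.inr hi, hne⟩, rfl⟩

theorem IsSemilatticeOrdered.of_surjective {A B : Alg (extType τ)} (f : Hom A B)
    (hf : Function.Surjective f.toFun) (hA : IsSemilatticeOrdered A) :
    IsSemilatticeOrdered B where
  assoc a b c := by
    obtain ⟨a, rfl⟩ := hf a
    obtain ⟨b, rfl⟩ := hf b
    obtain ⟨c, rfl⟩ := hf c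
    simp only [← f.map_plus, hA.assoc]
  comm a b := by
    obtain ⟨a, rfl⟩ := hf a
    obtain ⟨b, rfl⟩ := hf b
    simp only [← f.map_plus, hA.comm a b]
  idem a := by
    obtain ⟨a, rfl⟩ := hf a
    rw [← f.map_plus, hA.idem]
  distrib ω i x y z := by
    choose x' hx using fun j => hf (x j)
    obtain rfl : (fun j => f.toFun (x' j)) = x := funext hx
    obtain ⟨y, rfl⟩ := hf y
    obtain ⟨z, rfl⟩ := hf z
    have key : ∀ a, (reduct B).op ω (Function.update (fun j => f.toFun (x' j)) i (f.toFun a)) =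
        f.toFun ((reduct A).op ω (Function.update x' i a)) := fun a => by
      refine Eq.trans ?_ (f.mapReduct.map_op ω _).symm
      exact congrArg ((reduct B).op ω) (Function.comp_update f.toFun x' i a).symm
    rw [← f.map_plus, key, key, key, hA.distrib, f.map_plus]

theorem IsSemilatticeOrdered.of_injective {A B : Alg (extType τ)} (f : Hom B A)
    (hf : Function.Injective f.toFun) (hA : IsSemilatticeOrdered A) :
    IsSemilatticeOrdered B where
  assoc a b c := hf (by simp only [f.map_plus, hA.assoc])
  comm a b := hf (by simp only [f.map_plus, hA.comm (f.toFun a)])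
  idem a := hf (by rw [f.map_plus, hA.idem])
  distrib ω i x y z := hf (by
    have key : ∀ a, f.toFun ((reduct B).op ω (Function.update x i a)) =
        (reduct A).op ω (Function.update (fun j => f.toFun (x j)) i (f.toFun a)) := fun a =>
      (f.mapReduct.map_op ω _).trans
        (congrArg ((reduct A).op ω) (Function.comp_update f.toFun x i a))
    rw [f.map_plus, key, key, key, f.map_plus, hA.distrib])

theorem IsSemilatticeOrdered.prod {I : Type u} {A : I → Alg (extType τ)}
    (hA : ∀ i, IsSemilatticeOrdered (A i)) : IsSemilatticeOrdered (prodAlg A) := by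
  have hp : ∀ (i : I) (a b : prodAlg A), plus (prodAlg A) a b i = plus (A i) (a i) (b i) :=
    fun i => (projHom A i).map_plus
  refine ⟨fun a b c => funext fun i => ?_, fun a b => funext fun i => ?_,
    fun a => funext fun i => ?_, fun ω k x y z => funext fun i => ?_⟩
  · simp only [hp, (hA i).assoc]
  · rw [hp, hp, (hA i).comm]
  · rw [hp, (hA i).idem]
  · have key : ∀ a : prodAlg A, (reduct (prodAlg A)).op ω (Function.update x k a) i =
        (reduct (A i)).op ω (Function.update (fun j => x j i) k (a i)) := fun a =>
      congrArg ((reduct (A i)).op ω)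
        (Function.comp_update (fun q : prodAlg A => q i) x k a)
    rw [hp, key, key, key, hp, (hA i).distrib]

/-- The order of a semilattice ordered algebra. -/
abbrev IsSemilatticeOrdered.semilatticeSup {D : Alg (extType τ)} (hD : IsSemilatticeOrdered D) :
    SemilatticeSup D :=
  @SemilatticeSup.mk' D ⟨plus D⟩ hD.comm hD.assoc hD.idem

/-- The sum of the elements of a finite non-empty set. -/
noncomputable def IsSemilatticeOrdered.join {D : Alg (extType τ)} (hD : IsSemilatticeOrdered D)
    (P : FinPow D) : D :=
  letI := hD.semilatticeSup
  P.2.2.toFinset.sup' (P.2.2.toFinset_nonempty.2 P.2.1) id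

theorem IsSemilatticeOrdered.join_le_iff {D : Alg (extType τ)} (hD : IsSemilatticeOrdered D)
    (P : FinPow D) (u : D) :
    letI := hD.semilatticeSup
    hD.join P ≤ u ↔ ∀ a ∈ P.1, a ≤ u := by
  simp [IsSemilatticeOrdered.join, Finset.sup'_le_iff]

theorem IsSemilatticeOrdered.le_join {D : Alg (extType τ)} (hD : IsSemilatticeOrdered D)
    {P : FinPow D} {a : D} (ha : a ∈ P.1) :
    letI := hD.semilatticeSup
    a ≤ hD.join P :=
  letI := hD.semilatticeSup
  (hD.join_le_iff P _).1 le_rfl a ha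

theorem IsSemilatticeOrdered.join_single {D : Alg (extType τ)} (hD : IsSemilatticeOrdered D)
    (a : D) : hD.join (FinPow.single a) = a :=
  letI := hD.semilatticeSup
  le_antisymm ((hD.join_le_iff _ _).2 fun _ hb => le_of_eq hb) (hD.le_join rfl)

theorem IsSemilatticeOrdered.join_union {D : Alg (extType τ)} (hD : IsSemilatticeOrdered D)
    (P Q : FinPow D) : hD.join (P.union Q) = plus D (hD.join P) (hD.join Q) := by
  let _ := hD.semilatticeSup
  refine eq_of_forall_ge_iff fun c => (hD.join_le_iff _ c).trans ?_
  refine Iff.trans ?_ (sup_le_iff (a := hD.join P) (b := hD.join Q)).symm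
  rw [hD.join_le_iff, hD.join_le_iff]
  exact ⟨fun h => ⟨fun a ha => h a (Or.inl ha), fun a ha => h a (Or.inr ha)⟩,
    fun h a ha => ha.elim (h.1 a) (h.2 a)⟩

theorem IsSemilatticeOrdered.op_update_mono {D : Alg (extType τ)} (hD : IsSemilatticeOrdered D)
    (ω : Ω) (i : Fin (τ ω)) (x : Fin (τ ω) → D) {a b : D} :
    letI := hD.semilatticeSup
    a ≤ b → D.op (some ω) (Function.update x i a) ≤ D.op (some ω) (Function.update x i b) := by
  let _ := hD.semilatticeSup
  intro hab
  have h : plus D a b = b := sup_eq_right.2 hab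
  refine sup_eq_right.1 ((hD.distrib ω i x a b).symm.trans ?_)
  rw [h]

theorem IsSemilatticeOrdered.op_mono {D : Alg (extType τ)} (hD : IsSemilatticeOrdered D)
    (ω : Ω) (x y : Fin (τ ω) → D) :
    letI := hD.semilatticeSup
    (∀ i, x i ≤ y i) → D.op (some ω) x ≤ D.op (some ω) y := by
  let _ := hD.semilatticeSup
  intro hxy
  classical
  -- Arguments are raised from `x` to `y` one coordinate at a time.
  have key : ∀ J : Finset (Fin (τ ω)), D.op (some ω) x ≤ D.op (some ω) (J.piecewise y x) := by
    intro J
    induction J using Finset.induction_on with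
    | empty => rw [Finset.piecewise_empty]
    | insert i J hi ih =>
      refine ih.trans ?_
      rw [Finset.piecewise_insert]
      conv_lhs => rw [← Function.update_eq_self i (J.piecewise y x)]
      refine hD.op_update_mono ω i _ ?_
      rw [Finset.piecewise_eq_of_notMem _ _ _ hi]
      exact hxy i
  simpa using key Finset.univ

theorem IsSemilatticeOrdered.op_update_join {D : Alg (extType τ)}
    (hD : IsSemilatticeOrdered D) (ω : Ω) (i : Fin (τ ω)) (x : Fin (τ ω) → D) (P : FinPow D) :
    D.op (some ω) (Function.update x i (hD.join P)) =
      hD.join (P.map fun a => D.op (some ω) (Function.update x i a)) := by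
  induction P using FinPow.induction with
  | single a => rw [FinPow.map_single, hD.join_single, hD.join_single]
  | union P Q hP hQ =>
    rw [FinPow.map_union, hD.join_union, hD.join_union, ← hP, ← hQ]
    exact hD.distrib ω i x _ _

/-- Distributivity in all arguments at once; this is what makes summation a homomorphism. -/
theorem IsSemilatticeOrdered.join_op {D : Alg (extType τ)} (hD : IsSemilatticeOrdered D)
    (ω : Ω) (S : Fin (τ ω) → FinPow D) :
    hD.join ((powAlg (reduct D)).op (some ω) S) = D.op (some ω) fun i => hD.join (S i) := by
  let _ := hD.semilatticeSup
  refine le_antisymm ((hD.join_le_iff _ _).2 ?_) ?_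
  · rintro _ ⟨x, hx, rfl⟩
    exact hD.op_mono ω _ _ fun i => hD.le_join (hx i)
  -- `J` is the set of coordinates still holding a join; each induction step expands one of them by
  -- `op_update_join`.
  · have key : ∀ (J : Finset (Fin (τ ω))) (x : Fin (τ ω) → D), (∀ i ∉ J, x i ∈ (S i).1) →
        (∀ i ∈ J, x i = hD.join (S i)) →
        D.op (some ω) x ≤ hD.join ((powAlg (reduct D)).op (some ω) S) := by
      intro J
      induction J using Finset.induction_on with
      | empty => exact fun x hx _ => hD.le_join ⟨x, fun i => hx i (Finset.notMem_empty i), rfl⟩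
      | insert j J hj ih =>
        intro x hx hxJ
        rw [← Function.update_eq_self j x, hxJ j (Finset.mem_insert_self j J),
          hD.op_update_join, hD.join_le_iff]
        rintro _ ⟨a, ha, rfl⟩
        refine ih _ (fun i hi => ?_) fun i hi => ?_
        · rcases eq_or_ne i j with rfl | hij
          · rwa [Function.update_self]
          · rw [Function.update_of_ne hij]
            exact hx i (by simp [hij, hi])
        · rw [Function.update_of_ne (ne_of_mem_of_not_mem hi hj)]
          exact hxJ i (Finset.mem_insert_of_mem hi)
    exact key Finset.univ _ (fun i hi => absurd (Finset.mem_univ i) hi) fun i _ => rfl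

/-- Summation of finite non-empty sets, as a homomorphism. -/
noncomputable def joinHom {D : Alg (extType τ)} (hD : IsSemilatticeOrdered D) :
    Hom (powAlg (reduct D)) D :=
  Hom.ofPlus hD.join hD.join_op hD.join_union

/-- The extension of a homomorphism `A → (D, Ω)` to the extended power algebra of `A`. -/
noncomputable def Hom.extend {A : Alg τ} {D : Alg (extType τ)} (hD : IsSemilatticeOrdered D)
    (f : Hom A (reduct D)) : Hom (powAlg A) D :=
  (joinHom hD).comp (mapHom f)

theorem Hom.extend_single {A : Alg τ} {D : Alg (extType τ)} (hD : IsSemilatticeOrdered D)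
    (f : Hom A (reduct D)) (a : A) : (f.extend hD).toFun (FinPow.single a) = f.toFun a := by
  change hD.join ((FinPow.single a).map f.toFun) = _
  rw [FinPow.map_single]
  exact hD.join_single _

/-- Homomorphisms from the extended power algebra of a term algebra lift along surjections. -/
theorem exists_lift {X : Type u} {B D : Alg (extType τ)} (hB : IsSemilatticeOrdered B)
    (f : Hom B D) (hf : Function.Surjective f.toFun) (h : Hom (powAlg (freeAlg τ X)) D) :
    ∃ g : Hom (powAlg (freeAlg τ X)) B, ∀ P, f.toFun (g.toFun P) = h.toFun P := by
  choose e he using fun x => hf (h.toFun (FinPow.single (Term.var x)))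
  refine ⟨(evalHom (reduct B) e).extend hB, powAlg_free_hom_ext
    (f := f.comp ((evalHom (reduct B) e).extend hB)) fun x => ?_⟩
  change f.toFun (((evalHom (reduct B) e).extend hB).toFun _) = _
  rw [Hom.extend_single]
  exact he x

end Power

end SemilatticeOrdered

namespace SemilatticeOrdered

/-! ### Congruences of the power algebra versus closure operators. -/

section Closure

variable {Ω : Type u} {τ : Ω → ℕ}

theorem Congruence.refl {A : Alg τ} (θ : Congruence A) (a : A) : θ.r a a := θ.iseqv.refl a

theorem Congruence.symm {A : Alg τ} (θ : Congruence A) {a b : A} (h : θ.r a b) : θ.r b a :=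
  θ.iseqv.symm h

theorem Congruence.trans {A : Alg τ} (θ : Congruence A) {a b c : A} (h : θ.r a b)
    (k : θ.r b c) : θ.r a c :=
  θ.iseqv.trans h k

theorem Congruence.union {A : Alg τ} (Υ : Congruence (powAlg A)) {P P' Q Q' : FinPow A}
    (h : Υ.r P P') (k : Υ.r Q Q') : Υ.r (P.union Q) (P'.union Q') :=
  Υ.compat none ![P, Q] ![P', Q'] fun i =>
    Fin.cases (motive := fun i : Fin 2 => Υ.r (![P, Q] i) (![P', Q'] i)) h
      (fun j => by rw [Subsingleton.elim j 0]; exact k) i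

/-- A congruence of the extended power algebra, from its compatibility with the `Ω`-operations
and with `+`. -/
def Congruence.ofUnion {A : Alg τ} (s : Setoid (FinPow A))
    (op : ∀ (ω : Ω) (x y : Fin (τ ω) → FinPow A), (∀ i, s.r (x i) (y i)) →
      s.r ((powAlg A).op (some ω) x) ((powAlg A).op (some ω) y))
    (union : ∀ P P' Q Q', s.r P P' → s.r Q Q' → s.r (P.union Q) (P'.union Q')) :
    Congruence (powAlg A) where
  toSetoid := s
  compat
    | none => fun _ _ h => union _ _ _ _ (h (0 : Fin 2)) (h (1 : Fin 2))
    | some ω => op ω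

variable {A : Alg τ} (Υ : Congruence (powAlg A))

theorem opOf_mono {T T' : Set A} (h : T ⊆ T') : opOf Υ.r T ⊆ opOf Υ.r T' :=
  fun _ ⟨U, hU, hr⟩ => ⟨U, hU.trans h, hr⟩

/-- A witness `U ⊆ Q` can be enlarged to `Q` by joining `Q` to both sides. So the existential in
`opOf` disappears for finite sets. -/
theorem subset_opOf_iff (Q R : FinPow A) : R.1 ⊆ opOf Υ.r Q.1 ↔ Υ.r (Q.union R) Q := by
  induction R using FinPow.induction with
  | single a =>
    rw [FinPow.single_subset]
    refine ⟨fun ⟨U, hU, h⟩ => ?_, fun h => ⟨Q, subset_rfl, h⟩⟩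
    have h' := Υ.union (Υ.refl Q) h
    rwa [← FinPow.union_assoc, FinPow.union_eq_left hU] at h'
  | union R S hR hS =>
    have hu : (R.union S).1 ⊆ opOf Υ.r Q.1 ↔ R.1 ⊆ opOf Υ.r Q.1 ∧ S.1 ⊆ opOf Υ.r Q.1 :=
      Set.union_subset_iff
    rw [hu, hR, hS, ← FinPow.union_assoc]
    refine ⟨fun ⟨h, k⟩ => Υ.trans (Υ.union h (Υ.refl S)) k, fun h => ?_⟩
    -- Convexity: Q ∪ P is related to (Q ∪ R ∪ S) ∪ P, which equals Q ∪ R ∪ S and so is related to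
    -- Q.
    have key : ∀ P : FinPow A, P.1 ⊆ R.1 ∪ S.1 → Υ.r (Q.union P) Q := fun P hP => by
      have h' := Υ.union (Υ.symm h) (Υ.refl P)
      rw [FinPow.union_eq_left (P := (Q.union R).union S) fun a ha =>
        (hP ha).elim (fun h => Or.inl (Or.inr h)) Or.inr] at h'
      exact Υ.trans h' h
    exact ⟨key R Set.subset_union_left, key S Set.subset_union_right⟩

theorem subset_opOf_of_rel {Q R : FinPow A} (h : Υ.r Q R) {P : FinPow A} (hP : P.1 ⊆ Q.1) :
    P.1 ⊆ opOf Υ.r R.1 := by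
  have h' := Υ.union (Υ.symm h) (Υ.refl P)
  rw [FinPow.union_eq_left hP] at h'
  exact (subset_opOf_iff Υ R P).2 (Υ.trans h' h)

/-- Finitely many finite witnesses unite into one; this reduces idempotence of `opOf` on arbitrary
sets to finite sets. -/
theorem exists_subset_opOf {T : Set A} (U : FinPow A) (hU : U.1 ⊆ opOf Υ.r T) :
    ∃ W : FinPow A, W.1 ⊆ T ∧ U.1 ⊆ opOf Υ.r W.1 := by
  induction U using FinPow.induction with
  | single a =>
    obtain ⟨W, hW, h⟩ := hU rfl
    exact ⟨W, hW, (subset_opOf_iff Υ W _).2 h⟩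
  | union P Q hP hQ =>
    obtain ⟨V, hV, hPV⟩ := hP (Set.subset_union_left.trans hU)
    obtain ⟨W, hW, hQW⟩ := hQ (Set.subset_union_right.trans hU)
    exact ⟨V.union W, Set.union_subset hV hW, Set.union_subset
      (hPV.trans (opOf_mono Υ Set.subset_union_left))
      (hQW.trans (opOf_mono Υ Set.subset_union_right))⟩

theorem subset_opOf (T : Set A) : T ⊆ opOf Υ.r T := fun a ha =>
  ⟨FinPow.single a, Set.singleton_subset_iff.2 ha, by
    rw [FinPow.union_self]⟩

theorem opOf_opOf (T : Set A) : opOf Υ.r (opOf Υ.r T) = opOf Υ.r T := by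
  refine Set.Subset.antisymm (fun a ⟨U, hU, ha⟩ => ?_) (subset_opOf Υ _)
  obtain ⟨W, hW, hUW⟩ := exists_subset_opOf Υ U hU
  have h := (subset_opOf_iff Υ W U).1 hUW
  have hWa : Υ.r (W.union (FinPow.single a)) W := by
    refine Υ.trans (Υ.union (Υ.symm h) (Υ.refl _)) ?_
    rw [FinPow.union_assoc]
    exact Υ.trans (Υ.union (Υ.refl W) ha) h
  exact ⟨W, hW, hWa⟩

/-- The closure operator of a congruence of the extended power algebra. -/
def closureOf : ClosureOperator (Set A) where
  toFun := opOf Υ.r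
  monotone' _ _ h := opOf_mono Υ h
  le_closure' := subset_opOf Υ
  idempotent' := opOf_opOf Υ

/-- Equal closures make both Q and R related to Q ∪ R. This is one half of the bijection;
`closure_eq_opOf` is the other. -/
theorem upsilon_closureOf (Q R : FinPow A) : upsilon (closureOf Υ) Q R ↔ Υ.r Q R := by
  constructor
  · intro h
    have h₁ : R.1 ⊆ opOf Υ.r Q.1 := (subset_opOf Υ R.1).trans (Eq.ge h)
    have h₂ : Q.1 ⊆ opOf Υ.r R.1 := (subset_opOf Υ Q.1).trans (Eq.le h)
    rw [subset_opOf_iff] at h₁ h₂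
    rw [FinPow.union_comm] at h₂
    exact Υ.trans (Υ.symm h₁) h₂
  · intro h
    have key : ∀ {Q R : FinPow A}, Υ.r Q R → closureOf Υ Q.1 ≤ closureOf Υ R.1 := fun h =>
      ClosureOperator.le_closure_iff.1 (subset_opOf_of_rel Υ h subset_rfl)
    exact le_antisymm (key h) (key (Υ.symm h))

theorem single_mem_closure_iff (C : ClosureOperator (Set A)) (F : FinPow A) (a : A) :
    upsilon C (F.union (FinPow.single a)) F ↔ a ∈ C F.1 := by
  constructor
  · exact fun h => Eq.le h (C.le_closure _ (Or.inr rfl))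
  · exact fun h => le_antisymm (ClosureOperator.le_closure_iff.1
      (Set.union_subset (C.le_closure _) (Set.singleton_subset_iff.2 h)))
      (C.monotone Set.subset_union_left)

theorem closure_eq_opOf (C : ClosureOperator (Set A))
    (hC : ∀ B, C B = ⋃ F : {F : FinPow A // F.1 ⊆ B}, C F.1.1) (T : Set A) :
    C T = opOf (upsilon C) T := by
  ext a
  rw [hC, Set.mem_iUnion]
  constructor
  · rintro ⟨⟨F, hF⟩, ha⟩
    exact ⟨F, hF, (single_mem_closure_iff C F a).2 ha⟩
  · rintro ⟨F, hF, ha⟩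
    exact ⟨⟨F, hF⟩, (single_mem_closure_iff C F a).1 ha⟩

theorem upsilon_union (C : ClosureOperator (Set A)) {P P' Q Q' : FinPow A}
    (h : upsilon C P P') (k : upsilon C Q Q') : upsilon C (P.union Q) (P'.union Q') := by
  have key : ∀ {P P' Q Q' : FinPow A}, upsilon C P P' → upsilon C Q Q' →
      C (P.union Q).1 ≤ C (P'.union Q').1 := fun {P P' Q Q'} h k =>
    ClosureOperator.le_closure_iff.1 (Set.union_subset
      ((C.le_closure P.1).trans (h.le.trans (C.monotone Set.subset_union_left)))
      ((C.le_closure Q.1).trans (k.le.trans (C.monotone Set.subset_union_right))))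
  exact le_antisymm (key h k) (key h.symm k.symm)

end Closure

/-! ### Admissible congruences and the operators in Clo⁰_fi. -/

section Admissible

variable {Ω : Type u} {τ : Ω → ℕ} {X : Type u} {α : Congruence (freeAlg τ X)}

theorem map_out_map_cls (P : FinPow (quot (freeAlg τ X) α)) :
    (P.map Quotient.out).map α.cls = P := by
  rw [FinPow.map_map]
  simp only [Congruence.cls, Quotient.out_eq]
  exact FinPow.map_id' P

theorem eval_eq_apply_single {D : Alg (extType τ)} (φ : Hom (powAlg (freeAlg τ X)) D)
    (t : Term τ X) :
    t.eval (reduct D) (fun x => φ.toFun (FinPow.single (Term.var x))) =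
      φ.toFun (FinPow.single t) :=
  (φ.onSingle.apply_eq_eval t).symm

/-- A congruence `Υ` of the extended power algebra of `F_𝒰(X)/α` is admissible if it separates
singletons and is compatible with the substitution of finite sets for variables. -/
structure IsAdmissible (Υ : Congruence (powAlg (quot (freeAlg τ X) α))) : Prop where
  single : ∀ a b, Υ.r (FinPow.single a) (FinPow.single b) → a = b
  subst : ∀ (φ : Hom (powAlg (freeAlg τ X)) (powAlg (quot (freeAlg τ X) α)))
    (Q R : FinPow (freeAlg τ X)), Υ.r (Q.map α.cls) (R.map α.cls) →
      Υ.r (φ.toFun Q) (φ.toFun R)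

/-- The closure operator of an admissible congruence. -/
noncomputable def IsAdmissible.clo {Υ : Congruence (powAlg (quot (freeAlg τ X) α))} (h : IsAdmissible Υ) :
    CloFi0 α where
  cl := closureOf Υ
  algebraic B := by
    ext a
    rw [Set.mem_iUnion]
    constructor
    · rintro ⟨U, hU, ha⟩
      exact ⟨⟨U, hU⟩, U, subset_rfl, ha⟩
    · rintro ⟨⟨F, hF⟩, ha⟩
      exact opOf_mono Υ hF ha
  empty := Set.eq_empty_of_forall_notMem fun _ ⟨U, hU, _⟩ =>
    U.2.1.ne_empty (Set.subset_empty_iff.1 hU)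
  op_subset ω _ T := by
    rintro _ ⟨x, hx, rfl⟩
    have hT : ∀ i, Υ.r ((T i).union (FinPow.single (x i))) (T i) := fun i =>
      (subset_opOf_iff Υ _ _).1 (FinPow.single_subset.2 (hx i))
    exact FinPow.single_subset.1 (subset_opOf_of_rel Υ (Υ.compat (some ω) _ _ hT)
      (FinPow.single_subset.2 ⟨x, fun i => Or.inr rfl, rfl⟩))
  endo_subset φ T r hr := by
    have hT := (subset_opOf_iff Υ T _).1 (FinPow.single_subset.2 hr)
    -- An endomorphism becomes a substitution after composing with the projection from sets of
    -- terms.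
    have h' := h.subst (φ.comp (mapHom (clsHom α))) ((T.union (FinPow.single r)).map Quotient.out)
      (T.map Quotient.out) (by rwa [map_out_map_cls, map_out_map_cls])
    change Υ.r (φ.toFun (((T.union (FinPow.single r)).map Quotient.out).map α.cls))
      (φ.toFun ((T.map Quotient.out).map α.cls)) at h'
    rw [map_out_map_cls, map_out_map_cls] at h'
    exact subset_opOf_of_rel Υ h' (φ.apply_mono Set.subset_union_right)
  singleton_inj a b :=
    ⟨fun hab => h.single a b ((upsilon_closureOf Υ _ _).1 hab), fun hab => by rw [hab]⟩
  subst s Q P hs := by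
    -- By freeness, the family `P` is a homomorphism `φ`, whose values on singletons are the
    -- evaluated terms.
    let φ := (evalHom (reduct (powAlg (quot (freeAlg τ X) α))) fun x =>
      (P x).map α.cls).extend (isSemilatticeOrdered_powAlg _)
    have hφ : ∀ t : Term τ X, (φ.toFun (FinPow.single t)) =
        t.eval (reduct (powAlg (quot (freeAlg τ X) α))) fun x => (P x).map α.cls := fun t =>
      Hom.extend_single _ _ _
    have hQ : Υ.r ((Q.union (FinPow.single s)).map α.cls) (Q.map α.cls) := by
      rw [FinPow.map_union, FinPow.map_single]
      exact (subset_opOf_iff Υ _ _).1 (FinPow.single_subset.2 hs)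
    have h' := subset_opOf_of_rel Υ (h.subst φ _ _ hQ)
      (φ.apply_mono (P := FinPow.single s) Set.subset_union_right)
    rw [φ.apply_eq_iUnion Q] at h'
    simp only [hφ] at h'
    exact h'

theorem IsAdmissible.upsilon_clo {Υ : Congruence (powAlg (quot (freeAlg τ X) α))}
    (h : IsAdmissible Υ) (Q R : FinPow (quot (freeAlg τ X) α)) :
    upsilon h.clo.cl Q R ↔ Υ.r Q R :=
  upsilon_closureOf Υ Q R

/-- `Υ_C` as a congruence. -/
noncomputable def CloFi0.congruence (C : CloFi0 α) : Congruence (powAlg (quot (freeAlg τ X) α)) :=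
  Congruence.ofUnion ⟨upsilon C.cl, fun _ => rfl, fun h => h.symm, fun h k => h.trans k⟩
    (by
      have key : ∀ (ω : Ω) (x y : Fin (τ ω) → FinPow (quot (freeAlg τ X) α)), 0 < τ ω →
          (∀ i, upsilon C.cl (x i) (y i)) →
          C.cl ((powAlg _).op (some ω) x).1 ≤ C.cl ((powAlg _).op (some ω) y).1 := by
        refine fun ω x y hω h => ClosureOperator.le_closure_iff.1 ?_
        rintro _ ⟨z, hz, rfl⟩
        exact C.op_subset ω hω y ⟨z, fun i => (h i).le (C.cl.le_closure _ (hz i)), rfl⟩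
      intro ω x y h
      -- `op_subset` says nothing about constants, but there the two empty argument lists coincide.
      rcases Nat.eq_zero_or_pos (τ ω) with h0 | h0
      · have : IsEmpty (Fin (τ ω)) := by rw [h0]; infer_instance
        rw [Subsingleton.elim x y]
      · exact le_antisymm (key ω x y h0 h) (key ω y x h0 fun i => (h i).symm))
    fun _ _ _ _ h k => upsilon_union C.cl h k

/-- Choosing representatives of the sets φ({x}) turns an arbitrary φ into a family `P`, to which
`C.subst` applies one term at a time. -/
theorem CloFi0.isAdmissible (C : CloFi0 α) : IsAdmissible C.congruence where
  single a b h := (C.singleton_inj a b).1 h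
  subst φ Q R h := by
    let P : X → FinPow (freeAlg τ X) := fun x =>
      (φ.toFun (FinPow.single (Term.var x))).map Quotient.out
    have hP : ∀ t : Term τ X, t.eval (reduct (powAlg (quot (freeAlg τ X) α)))
        (fun x => (P x).map α.cls) = φ.toFun (FinPow.single t) := fun t =>
      (congrArg (fun e => Term.eval (reduct (powAlg (quot (freeAlg τ X) α))) e t)
        (funext fun x => map_out_map_cls _)).trans (eval_eq_apply_single φ t)
    have key : ∀ {Q R : FinPow (freeAlg τ X)}, upsilon C.cl (Q.map α.cls) (R.map α.cls) →
        C.cl (φ.toFun Q).1 ≤ C.cl (φ.toFun R).1 := by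
      intro Q R h
      refine ClosureOperator.le_closure_iff.1 ?_
      rw [φ.apply_eq_iUnion Q, φ.apply_eq_iUnion R]
      refine Set.iUnion₂_subset fun q hq => ?_
      have hs := C.subst q R P (h.le (C.cl.le_closure _ ⟨q, hq, rfl⟩))
      simp only [hP] at hs
      exact hs
    exact le_antisymm (key h) (key (Eq.symm h))

theorem CloFi0.cl_eq_opOf (C : CloFi0 α) (T : Set (quot (freeAlg τ X) α)) :
    C.cl T = opOf (upsilon C.cl) T :=
  closure_eq_opOf C.cl C.algebraic T

theorem CloFi0.ext_upsilon {C D : CloFi0 α}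
    (h : ∀ Q R, upsilon C.cl Q R ↔ upsilon D.cl Q R) : C = D := by
  have hCD : C.cl = D.cl := ClosureOperator.ext _ _ fun T => by
    rw [C.cl_eq_opOf, D.cl_eq_opOf,
      show upsilon C.cl = upsilon D.cl from funext₂ fun Q R => propext (h Q R)]
  cases C
  cases D
  cases hCD
  rfl

/-- The intersection of a family of congruences. -/
def iInfCongruence {A : Alg τ} {I : Type v} (θ : I → Congruence A) : Congruence A where
  r a b := ∀ i, (θ i).r a b
  iseqv := ⟨fun a i => (θ i).refl a, fun h i => (θ i).symm (h i),
    fun h k i => (θ i).trans (h i) (k i)⟩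
  compat ω x y h i := (θ i).compat ω x y fun j => h j i

/-- A single member of the family already separates singletons, hence the non-empty index type. -/
theorem isAdmissible_iInf {I : Type v} [Nonempty I]
    {Υ : I → Congruence (powAlg (quot (freeAlg τ X) α))} (h : ∀ i, IsAdmissible (Υ i)) :
    IsAdmissible (iInfCongruence Υ) where
  single a b hab := (h (Classical.arbitrary I)).single a b (hab _)
  subst φ Q R hQR i := (h i).subst φ Q R (hQR i)

theorem exists_isLUB_cloFi0 {I : Type v} [Nonempty I] (C : I → CloFi0 α) :
    ∃ D : CloFi0 α, (∀ T, D.cl T = opOf (fun Q R => ∀ i, upsilon (C i).cl Q R) T) ∧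
      IsLUB (Set.range C) D := by
  have h := isAdmissible_iInf fun i => (C i).isAdmissible
  refine ⟨h.clo, fun T => rfl, ?_, fun E hE Q R hQR => ?_⟩
  · rintro _ ⟨i, rfl⟩ Q R hQR
    exact (h.upsilon_clo Q R).1 hQR i
  · exact (h.upsilon_clo Q R).2 fun i => hE ⟨i, rfl⟩ Q R hQR

end Admissible

end SemilatticeOrdered

namespace SemilatticeOrdered

/-! ### The Galois correspondence between subvarieties and admissible congruences. -/

section Galois

variable {Ω : Type u} {τ : Ω → ℕ} {X : Type u} {α : Congruence (freeAlg τ X)}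

theorem Hom.apply_map_out {B : Alg (extType τ)} (hB : reduct B ∈ models α.r)
    (h : Hom (powAlg (freeAlg τ X)) B) (Q : FinPow (freeAlg τ X)) :
    h.toFun ((Q.map α.cls).map Quotient.out) = h.toFun Q := by
  induction Q using FinPow.induction with
  | single t =>
    rw [FinPow.map_single, FinPow.map_single, ← eval_eq_apply_single, ← eval_eq_apply_single]
    exact hB _ _ (Quotient.mk_out t) _
  | union P Q hP hQ =>
    rw [FinPow.map_union, FinPow.map_union, h.map_union, h.map_union, hP, hQ]

/-- Homomorphisms from the extended power algebra of `F_𝒰(X)` into an algebra whose reduct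
satisfies `α` factor through the extended power algebra of `F_𝒰(X)/α`. -/
noncomputable def Hom.descend {B : Alg (extType τ)} (hB : reduct B ∈ models α.r)
    (h : Hom (powAlg (freeAlg τ X)) B) : Hom (powAlg (quot (freeAlg τ X) α)) B :=
  Hom.ofPlus (fun P => h.toFun (P.map Quotient.out))
    (fun ω x => by
      have hx : (powAlg (quot (freeAlg τ X) α)).op (some ω) x =
          ((powAlg (freeAlg τ X)).op (some ω) fun i => (x i).map Quotient.out).map α.cls := by
        refine Eq.trans ?_ ((mapHom (clsHom α)).map_op (some ω) _).symm
        exact congrArg _ (funext fun i => (map_out_map_cls (x i)).symm)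
      rw [hx, h.apply_map_out hB]
      exact h.map_op (some ω) _)
    (fun P Q => by
      rw [← h.map_union, ← FinPow.map_union]
      rfl)

theorem Hom.descend_map_cls {B : Alg (extType τ)} (hB : reduct B ∈ models α.r)
    (h : Hom (powAlg (freeAlg τ X)) B) (Q : FinPow (freeAlg τ X)) :
    (h.descend hB).toFun (Q.map α.cls) = h.toFun Q :=
  h.apply_map_out hB Q

/-- The congruence of all identities between finite sets that hold in `K`. -/
def idOf (α : Congruence (freeAlg τ X)) (K : Set (Alg (extType τ))) :
    Congruence (powAlg (quot (freeAlg τ X) α)) where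
  r Q R := ∀ B ∈ K, ∀ h : Hom (powAlg (quot (freeAlg τ X) α)) B, h.toFun Q = h.toFun R
  iseqv := ⟨fun _ _ _ _ => rfl, fun h B hB g => (h B hB g).symm,
    fun h k B hB g => (h B hB g).trans (k B hB g)⟩
  compat ω x y h B hB g := by
    rw [g.map_op, g.map_op]
    exact congrArg (B.op ω) (funext fun i => h i B hB g)

/-- The semilattice ordered algebras that satisfy the identities in `Υ`. -/
def modOf (Υ : Congruence (powAlg (quot (freeAlg τ X) α))) : Set (Alg (extType τ)) :=
  {B | IsSemilatticeOrdered B ∧ ∀ (h : Hom (powAlg (freeAlg τ X)) B)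
    (Q R : FinPow (freeAlg τ X)), Υ.r (Q.map α.cls) (R.map α.cls) → h.toFun Q = h.toFun R}

theorem isVariety_modOf (Υ : Congruence (powAlg (quot (freeAlg τ X) α))) :
    IsVariety (modOf Υ) where
  image A B f hf hA := by
    refine ⟨hA.1.of_surjective f hf, fun h Q R hQR => ?_⟩
    obtain ⟨g, hg⟩ := exists_lift hA.1 f hf h
    rw [← hg, ← hg, hA.2 g Q R hQR]
  sub A B f hf hA :=
    ⟨hA.1.of_injective f hf, fun h Q R hQR => hf (hA.2 (f.comp h) Q R hQR)⟩
  prod I A hA := ⟨IsSemilatticeOrdered.prod fun i => (hA i).1,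
    fun h Q R hQR => funext fun i => (hA i).2 ((projHom A i).comp h) Q R hQR⟩

/-- α-related terms give the same singleton over F_𝒰(X)/α, so reflexivity of Υ already imposes the
identities in α. -/
theorem reduct_mem_models {Υ : Congruence (powAlg (quot (freeAlg τ X) α))}
    {B : Alg (extType τ)} (hB : B ∈ modOf Υ) : reduct B ∈ models α.r := by
  intro s t hst e
  have h := hB.2 ((evalHom (reduct B) e).extend hB.1) (FinPow.single s) (FinPow.single t) (by
    rw [FinPow.map_single, FinPow.map_single, show α.cls s = α.cls t from Quotient.sound hst])
  rwa [Hom.extend_single, Hom.extend_single] at h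

/-- The free algebra, of the variety determined by an admissible congruence, belongs to it. -/
theorem IsAdmissible.quot_mem {Υ : Congruence (powAlg (quot (freeAlg τ X) α))}
    (hΥ : IsAdmissible Υ) : quot (powAlg (quot (freeAlg τ X) α)) Υ ∈ modOf Υ := by
  refine ⟨(isSemilatticeOrdered_powAlg _).of_surjective (clsHom Υ) (clsHom_surjective Υ),
    fun h Q R hQR => ?_⟩
  obtain ⟨g, hg⟩ := exists_lift (isSemilatticeOrdered_powAlg _) (clsHom Υ)
    (clsHom_surjective Υ) h
  rw [← hg, ← hg]
  exact Quotient.sound (hΥ.subst g Q R hQR)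

/-- The quotient by Υ is itself a model and refutes every pair outside Υ. -/
theorem IsAdmissible.idOf_modOf {Υ : Congruence (powAlg (quot (freeAlg τ X) α))}
    (hΥ : IsAdmissible Υ) (Q R : FinPow (quot (freeAlg τ X) α)) :
    (idOf α (modOf Υ)).r Q R ↔ Υ.r Q R := by
  refine ⟨fun h => Quotient.exact (h _ hΥ.quot_mem (clsHom Υ)), fun h B hB g => ?_⟩
  rw [← map_out_map_cls Q, ← map_out_map_cls R] at h ⊢
  exact hB.2 (g.comp (mapHom (clsHom α))) _ _ h

/-- Birkhoff's theorem for Ω ∪ {+}: sending x to {x} evaluates a term to a finite set of Ω-terms,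
and homomorphisms commute with this evaluation (`ε`), so an identity of terms becomes a pair of
sets. -/
theorem modOf_idOf [Infinite X] {K : Set (Alg (extType τ))} (hK : IsVariety K)
    (hKα : K ⊆ SLO (models α.r)) : modOf (idOf α K) = K := by
  refine Set.Subset.antisymm (fun B hB => ?_) fun B hB => ⟨(hKα hB).2, fun h Q R hQR => ?_⟩
  · let ε (C : Alg (extType τ)) (h : Hom (powAlg (freeAlg τ X)) C) (t : Term (extType τ) X) :
        h.toFun (t.eval (powAlg (freeAlg τ X)) fun x => FinPow.single (Term.var x)) =
          t.eval C fun x => h.toFun (FinPow.single (Term.var x)) := h.map_eval _ t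
    refine mem_of_identities (X := X) hK B fun s t hst e => ?_
    have h := hB.2 ((evalHom (reduct B) e).extend hB.1)
      (s.eval (powAlg (freeAlg τ X)) fun x => FinPow.single (Term.var x))
      (t.eval (powAlg (freeAlg τ X)) fun x => FinPow.single (Term.var x)) (fun C hC g => by
        have h' := hst C hC fun x =>
          (g.comp (mapHom (clsHom α))).toFun (FinPow.single (Term.var x))
        rwa [← ε, ← ε] at h')
    rw [ε, ε] at h
    have he : (fun x => ((evalHom (reduct B) e).extend hB.1).toFun
        (FinPow.single (Term.var x))) = e := funext fun x => Hom.extend_single _ _ _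
    rwa [he] at h
  · have h' := hQR B hB (h.descend (hKα hB).1)
    rwa [h.descend_map_cls, h.descend_map_cls] at h'

theorem IsAdmissible.isPreserved_modOf [Infinite X]
    {Υ : Congruence (powAlg (quot (freeAlg τ X) α))} (hΥ : IsAdmissible Υ)
    (hα : α.FullyInvariant) (hne : Nontrivial (quot (freeAlg τ X) α)) :
    IsPreserved (varietyOf α) (modOf Υ) where
  variety := isVariety_modOf Υ
  subset B hB := ⟨models_eq_varietyOf hα ▸ reduct_mem_models hB, hB.1⟩
  nontrivial := by
    obtain ⟨a, b, hab⟩ := hne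
    exact ⟨_, hΥ.quot_mem, Υ.cls (FinPow.single a), Υ.cls (FinPow.single b),
      fun h => hab (hΥ.single a b (Quotient.exact h))⟩
  preserved W hW hWV hsub := by
    -- Singletons embed F_𝒰(X)/α into the reduct of the free model, so `W` contains the generator of
    -- the whole variety.
    refine hWV.2 (HSP_subset hW (hW.sub _ _ (clsHom Υ).onSingle (fun a b h => ?_)
      (hsub hΥ.quot_mem).1))
    exact hΥ.single a b (Quotient.exact h)

theorem IsPreserved.subset_models [Infinite X] {K : Set (Alg (extType τ))}
    (hα : α.FullyInvariant) (hK : IsPreserved (varietyOf α) K) : K ⊆ SLO (models α.r) :=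
  (models_eq_varietyOf hα).symm ▸ hK.subset

theorem IsPreserved.isAdmissible_idOf [Infinite X] {K : Set (Alg (extType τ))}
    (hα : α.FullyInvariant) (hK : IsPreserved (varietyOf α) K) : IsAdmissible (idOf α K) where
  single a b hab := by
    -- `W` is cut out by the Ω-identities read off from collapsed singletons. Preservation forces it
    -- to contain the whole variety, so these identities hold in F_𝒰(X)/α.
    let W : Set (Alg τ) := models fun s t : Term τ X =>
      (idOf α K).r (FinPow.single (α.cls s)) (FinPow.single (α.cls t))
    have hW : IsVariety W := isVariety_models _
    have hKW : K ⊆ SLO (W ∩ varietyOf α) := fun B hB => by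
      refine ⟨⟨fun s t hst e => ?_, (hK.subset hB).1⟩, (hK.subset hB).2⟩
      have hB' := (hK.subset_models hα hB)
      have h := hst B hB (((evalHom (reduct B) e).extend hB'.2).descend hB'.1)
      rw [← FinPow.map_single, ← FinPow.map_single, Hom.descend_map_cls, Hom.descend_map_cls,
        Hom.extend_single, Hom.extend_single] at h
      exact h
    have hVW : varietyOf α ⊆ W ∩ varietyOf α := by
      by_contra hn
      exact hK.preserved _ (isVariety_inter hW (isVariety_HSP _))
        ⟨Set.inter_subset_right, hn⟩ hKW
    obtain ⟨s, rfl⟩ := clsHom_surjective α a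
    obtain ⟨t, rfl⟩ := clsHom_surjective α b
    have h := (hVW (self_mem_HSP _)).1 s t hab fun x => α.cls (Term.var x)
    rwa [eval_cls_var, eval_cls_var] at h
  subst φ Q R hQR B hB h := by
    -- Although `φ` need not factor through F_𝒰(X)/α, its composite with `h` does, because the
    -- reduct of `B` satisfies α.
    have hB' := (hK.subset_models hα hB).1
    have h' := hQR B hB ((h.comp φ).descend hB')
    rwa [Hom.descend_map_cls, Hom.descend_map_cls] at h'

/-- The isomorphism between preserved subvarieties and closure operators. -/
noncomputable def preservedOrderIso [Infinite X] (hα : α.FullyInvariant)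
    (hne : Nontrivial (quot (freeAlg τ X) α)) : Preserved (varietyOf α) ≃o CloFi0 α :=
  Equiv.toOrderIso
    { toFun := fun K => (K.2.isAdmissible_idOf hα).clo
      invFun := fun C => ⟨modOf C.congruence, C.isAdmissible.isPreserved_modOf hα hne⟩
      left_inv := fun K => by
        have h : (K.2.isAdmissible_idOf hα).clo.congruence.r = (idOf α K.1).r :=
          funext₂ fun Q R => propext ((K.2.isAdmissible_idOf hα).upsilon_clo Q R)
        refine Subtype.ext (Eq.trans ?_ (modOf_idOf K.2.variety (K.2.subset_models hα)))
        simp only [modOf, h]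
      right_inv := fun C => CloFi0.ext_upsilon fun Q R =>
        (IsAdmissible.upsilon_clo _ Q R).trans (C.isAdmissible.idOf_modOf Q R) }
    (fun K L hKL Q R hQR => by
      have hK := K.2.isAdmissible_idOf hα
      have hL := L.2.isAdmissible_idOf hα
      exact (hK.upsilon_clo Q R).2 fun B hB => (hL.upsilon_clo Q R).1 hQR B (hKL hB))
    (fun _ _ hCD _ hB => ⟨hB.1, fun h Q R hQR => hB.2 h Q R (hCD _ _ hQR)⟩)

theorem tilde_fullyInvariant {A : Alg τ} {Θ : Congruence (powAlg A)} (hΘ : Θ.FullyInvariant) :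
    Θ.tilde.FullyInvariant := by
  intro φ a b hab
  have h := hΘ (mapHom φ) _ _ hab
  rwa [mapHom_apply, mapHom_apply, FinPow.map_single, FinPow.map_single] at h

/-- If all singletons were related, then so would be their finite unions, and Θ would be full. -/
theorem nontrivial_quot_tilde {A : Alg τ} {Θ : Congruence (powAlg A)}
    (h : ∃ B C, ¬ Θ.r B C) : Nontrivial (quot A Θ.tilde) := by
  by_contra hn
  rw [not_nontrivial_iff_subsingleton] at hn
  obtain ⟨B, C, hBC⟩ := h
  obtain ⟨a, -⟩ := B.2.1
  have key : ∀ P : FinPow A, Θ.r P (FinPow.single a) := fun P => by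
    induction P using FinPow.induction with
    | single b =>
      exact Quotient.exact (s := Θ.tilde.toSetoid)
        (Subsingleton.elim (Θ.tilde.cls b) (Θ.tilde.cls a))
    | union P Q hP hQ => exact FinPow.union_self (FinPow.single a) ▸ Θ.union hP hQ
  exact hBC (Θ.trans (key B) (Θ.symm (key C)))

theorem isEmpty_preserved [Subsingleton (quot (freeAlg τ X) α)] :
    IsEmpty (Preserved (varietyOf α)) := by
  refine ⟨fun K => ?_⟩
  obtain ⟨B, hB, hne⟩ := K.2.nontrivial
  obtain ⟨I, S, i, p, hi, hp⟩ := (K.2.subset hB).1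
  have : Subsingleton S := hi.subsingleton
  exact not_subsingleton B hp.subsingleton

theorem exists_isLUB_preserved [Infinite X] (hα : α.FullyInvariant)
    (S : Set (Preserved (varietyOf α))) (hS : S.Nonempty) : ∃ K, IsLUB S K := by
  -- In the trivial case a non-empty `S` cannot exist; otherwise suprema are transported along the
  -- isomorphism.
  rcases subsingleton_or_nontrivial (quot (freeAlg τ X) α) with _ | hne
  · exact (isEmpty_preserved.false hS.some).elim
  · have := hS.to_subtype
    let f := preservedOrderIso hα hne
    obtain ⟨D, -, hD⟩ := exists_isLUB_cloFi0 fun K : S => f K.1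
    refine ⟨f.symm D, (f.isLUB_image').1 ?_⟩
    rw [f.apply_symm_apply]
    rwa [← Set.image_eq_range] at hD

end Galois

end SemilatticeOrdered

theorem theorem5p11 {Ω : Type u} (τ : Ω → ℕ) (X : Type u) [Infinite X]
    (Θ : Congruence (powAlg (freeAlg τ X))) (hΘ : Θ.FullyInvariant) :
    (∀ S : Set (Preserved (varietyOf Θ.tilde)), S.Nonempty → ∃ K, IsLUB S K) ∧
    ((∃ B C, ¬ Θ.r B C) → Nonempty (Preserved (varietyOf Θ.tilde) ≃o CloFi0 Θ.tilde)) ∧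
    (∀ (I : Type v) [Nonempty I] (C : I → CloFi0 Θ.tilde),
      ∃ D : CloFi0 Θ.tilde,
        (∀ T, D.cl T = opOf (fun Q R => ∀ i, upsilon (C i).cl Q R) T) ∧
        IsLUB (Set.range C) D) :=
  ⟨exists_isLUB_preserved (tilde_fullyInvariant hΘ),
    fun h => ⟨preservedOrderIso (tilde_fullyInvariant hΘ) (nontrivial_quot_tilde h)⟩,
    fun _ _ C => exists_isLUB_cloFi0 C⟩
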